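/- **Setting.** Write $\mu$ for Lebesgue measure on $[0,1]$ and $\|\cdot\|_p$ for the $L^p([0,1])$-norm; inequalities between functions in $L^1([0,1])$ hold almost everywhere and $(x)_+=\max(x,0)$. For $n\ge 1$ and $f\in L^1([0,1])$ let $P_f=P_f^n$ be the law of a Poisson point process $N$ on $[0,1]\times\mathbb R$ with intensity $\lambda_f(x,y)=n\,\mathbf 1(f(x)\le y)$ with respect to Lebesgue measure, and let $E_f$ be the expectation under $P_f$. Let $\Theta$ be a Polish space with its Borel $\sigma$-algebra that embeds continuously into $L^1([0,1])$ (its elements are regarded as functions), let $\Pi$ be a probability measure (the prior) on $\Theta$, and let $\Pi(\cdot\mid N)$ be the posterior distribution, i.e. the conditional distribution of $f$ given $N$ when $f\sim\Pi$ and $N\mid f\sim P_f$. Let $f_0\in L^1([0,1])$. For $F\subseteq L^1([0,1])$ and $\delta>0$, let $N(\delta,F,\|\cdot\|_\infty)$ be the smallest number of closed $\|\cdot\|_\infty$-balls of radius $\delta$ covering $F$ (centers in $L^1([0,1])$, not necessarily in $F$); let $N_{[}(\delta,F)$ be the smallest number $m$ of functions $\ell_1,\dots,\ell_m\in L^1([0,1])$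 such that for every $f\in F$ there is $j$ with $\ell_j\le f$ and $\int(f-\ell_j)\le\delta$; and let $$S_{[}(n,F,f_0)=\inf_{(\ell_j)_{j\in J}}\ \sum_{j\in J}e^{-n\int(\ell_j-f_0)_+}\in[0,\infty],$$ the infimum being over all $J\subseteq\mathbb Z$ and all families $(\ell_j)_{j\in J}\subset L^1([0,1])$ such that for every $f\in F$ there is $j\in J$ with $\ell_j\le f$. **Theorem 2.3.** For all constants $C,C'\ge 1$ and $A>0$ there is a constant $M>0$, depending only on $A,C,C'$, such that the following holds for all $C''\ge1$, all $\Theta,\Pi,f_0$ as above, all sequences of positive numbers $\varepsilon_n\to0$, all subsets $\Theta_n\subseteq\Theta$ and every $n\ge1$. If * (i) $N(\varepsilon_n,\Theta_n,\|\cdot\|_\infty)\le C''e^{C'n\varepsilon_n}$; * (ii) $\Pi\big(f:\|f-f_0\|_1\le A\varepsilon_n,\ f\le f_0\big)\ge e^{-Cn\varepsilon_n}$; * (iii) $\Pi(\Theta_n^c)\le C''e^{-(C+A+1)n\varepsilon_n}$; then $$E_{f_0}\Big[\Pi\big(f:\|f-f_0\|_1\ge M\varepsilon_n\mid N\big)\Big]\le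 3C''e^{-n\varepsilon_n}.$$ The same conclusion holds if (i) is replaced by any one of the following conditions: * $S_{[}\big(n,\{f\in\Theta_n:\int(f-f_0)_+\ge 4C'\varepsilon_n\},f_0\big)\le C''e^{-n\varepsilon_n}$; * $N_{[}(\varepsilon_n,\Theta_n)\le C''e^{C'n\varepsilon_n}$; * $N(C'\varepsilon_n,\Theta_n,\|\cdot\|_\infty)\le C''e^{C'n\varepsilon_n}$. -/

import Mathlib

open MeasureTheory ProbabilityTheory Filter Topology
open scoped ENNReal NNReal

theorem lintegral_natCast_poissonMeasure (r : ℝ≥0) :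
    ∫⁻ k : ℕ, (k : ℝ≥0∞) ∂(poissonMeasure r) = r := by
  have hs : HasSum (fun k : ℕ => Real.exp (-r) * r ^ k / (k.factorial : ℝ) * (k : ℝ)) (r : ℝ) := by
    rw [← hasSum_nat_add_iff' 1]
    have := (hasSum_one_poissonMeasure r).mul_left (r : ℝ)
    simp only [mul_one] at this
    have h0 : (r : ℝ) - ∑ k ∈ Finset.range 1,
        Real.exp (-r) * (r : ℝ) ^ k / (k.factorial : ℝ) * (k : ℝ) = r := by simp
    rw [h0]
    have e : (fun k : ℕ => (r : ℝ) * (Real.exp (-r) * (r : ℝ) ^ k / (k.factorial : ℝ))) =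
        fun k : ℕ => Real.exp (-r) * (r : ℝ) ^ (k + 1) / ((k + 1).factorial : ℝ) *
          ((k + 1 : ℕ) : ℝ) := by
      funext k
      rw [Nat.factorial_succ]
      push_cast
      field_simp
      ring
    rw [e] at this
    exact this
  rw [poissonMeasure, lintegral_sum_measure]
  simp only [lintegral_smul_measure, lintegral_dirac, smul_eq_mul]
  have : ∀ k : ℕ, ENNReal.ofReal (Real.exp (-r) * r ^ k / (k.factorial : ℝ)) * (k : ℝ≥0∞)
      = ENNReal.ofReal (Real.exp (-r) * r ^ k / (k.factorial : ℝ) * (k : ℝ)) := by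
    intro k
    rw [ENNReal.ofReal_mul (by positivity), ENNReal.ofReal_natCast]
  simp_rw [this]
  rw [← ENNReal.ofReal_tsum_of_nonneg (fun k => by positivity) hs.summable, hs.tsum_eq]
  simp

theorem integral_pow_poissonMeasure (r : ℝ≥0) (z : ℂ) :
    ∫ k : ℕ, z ^ k ∂(poissonMeasure r) = Complex.exp (r * (z - 1)) := by
  rw [integral_poissonMeasure]
  have h : HasSum (fun k : ℕ => (Real.exp (-r) : ℂ) * ((r * z) ^ k / k.factorial))
      ((Real.exp (-r) : ℂ) * Complex.exp (r * z)) := by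
    rw [Complex.exp_eq_exp_ℂ]
    exact (NormedSpace.expSeries_div_hasSum_exp (r * z : ℂ)).mul_left _
  have e : (Real.exp (-r) : ℂ) * Complex.exp (r * z) = Complex.exp (r * (z - 1)) := by
    rw [Complex.ofReal_exp, ← Complex.exp_add]; congr 1; push_cast; ring
  rw [← e, ← h.tsum_eq]
  refine tsum_congr fun k => ?_
  rw [Complex.real_smul]; push_cast; rw [mul_pow]; ring

theorem exists_poisson_charFun_of_isFiniteMeasure {E : Type*} [MeasurableSpace E]
    (Λ : Measure E) [IsFiniteMeasure Λ] :
    ∃ P : Measure (Measure E), IsProbabilityMeasure P ∧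
      (∀ B, MeasurableSet B → ∫⁻ N, N B ∂P = Λ B) ∧
      ∀ (m : ℕ) (B : Fin m → Set E), (∀ j, MeasurableSet (B j)) →
        Pairwise (Function.onFun Disjoint B) → ∀ t : Fin m → ℝ,
        ∫ N, Complex.exp (((∑ j, t j * (N (B j)).toReal : ℝ) : ℂ) * Complex.I) ∂P =
          Complex.exp (∑ j, ((Λ (B j)).toReal : ℂ) * (Complex.exp (t j * Complex.I) - 1)) := by
  rcases eq_or_ne Λ 0 with rfl | hΛ
  · refine ⟨Measure.dirac 0, inferInstance, fun B hB => ?_, fun m B hB _ t => ?_⟩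
    · rw [lintegral_dirac' _ (Measure.measurable_coe hB)]
    · rw [integral_dirac']
      · simp
      · apply Measurable.stronglyMeasurable
        have : ∀ j, Measurable fun N : Measure E => (N (B j)).toReal :=
          fun j => (Measure.measurable_coe (hB j)).ennreal_toReal
        fun_prop
  set r : ℝ≥0 := (Λ Set.univ).toNNReal with hr
  have hrΛ : (r : ℝ≥0∞) = Λ Set.univ := ENNReal.coe_toNNReal (measure_ne_top _ _)
  have hr0 : Λ Set.univ ≠ 0 := by simpa using hΛ
  set ν : Measure E := (Λ Set.univ)⁻¹ • Λ with hν
  have : NeZero Λ := ⟨hΛ⟩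
  have hνp : IsProbabilityMeasure ν := by rw [hν]; infer_instance
  have hνΛ : Λ = (r : ℝ≥0∞) • ν := by
    rw [hν, smul_smul, hrΛ, ENNReal.mul_inv_cancel hr0 (measure_ne_top _ _), one_smul]
  set Q : Measure (ℕ × (ℕ → E)) :=
    (poissonMeasure r).prod (Measure.infinitePi fun _ => ν) with hQ
  set φ : ℕ × (ℕ → E) → Measure E := fun w => ∑ i ∈ Finset.range w.1, Measure.dirac (w.2 i)
    with hφ
  have hφB : ∀ (w : ℕ × (ℕ → E)) (B : Set E), MeasurableSet B →
      φ w B = ∑ i ∈ Finset.range w.1, B.indicator 1 (w.2 i) := by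
    intro w B hB
    simp [hφ, Measure.dirac_apply' _ hB]
  have hφm : Measurable φ := by
    refine Measure.measurable_of_measurable_coe _ fun B hB => ?_
    simp_rw [hφB _ B hB]
    refine measurable_from_prod_countable_right fun k => ?_
    simp only
    refine Finset.measurable_fun_sum _ fun i _ => ?_
    exact (measurable_one.indicator hB).comp (measurable_pi_apply i)
  refine ⟨Q.map φ, Measure.isProbabilityMeasure_map hφm.aemeasurable, fun B hB => ?_,
    fun m B hB hd t => ?_⟩
  · rw [lintegral_map (Measure.measurable_coe hB) hφm, hQ,
      lintegral_prod (fun w => φ w B) ((Measure.measurable_coe hB).comp hφm).aemeasurable]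
    simp_rw [hφB _ B hB]
    have : ∀ k : ℕ, ∫⁻ x : ℕ → E, ∑ i ∈ Finset.range k, B.indicator (1 : E → ℝ≥0∞) (x i)
        ∂(Measure.infinitePi fun _ => ν) = (k : ℝ≥0∞) * ν B := by
      intro k
      have hm : ∀ i : ℕ, Measurable fun x : ℕ → E => B.indicator (1 : E → ℝ≥0∞) (x i) :=
        fun i => (measurable_one.indicator hB).comp (measurable_pi_apply i)
      rw [lintegral_finsetSum _ fun i _ => hm i]
      have : ∀ i : ℕ, ∫⁻ x : ℕ → E, B.indicator (1 : E → ℝ≥0∞) (x i)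
          ∂(Measure.infinitePi fun _ => ν) = ν B := by
        intro i
        rw [(measurePreserving_eval_infinitePi (fun _ : ℕ => ν) i).lintegral_comp
          (measurable_one.indicator hB), lintegral_indicator_one hB]
      simp [this]
    simp_rw [this]
    rw [lintegral_mul_const _ (by fun_prop), lintegral_natCast_poissonMeasure, hνΛ]
    simp
  · have hmB : ∀ j, Measurable fun N : Measure E => (N (B j)).toReal :=
      fun j => (Measure.measurable_coe (hB j)).ennreal_toReal
    set h : E → ℂ := fun x =>
      Complex.exp (((∑ j, t j * (B j).indicator 1 x : ℝ) : ℂ) * Complex.I) with hh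
    have hhm : Measurable h := by
      have : ∀ j, Measurable fun x => (B j).indicator (1 : E → ℝ) x :=
        fun j => measurable_one.indicator (hB j)
      fun_prop
    have hhn : ∀ x, ‖h x‖ = 1 := fun x => Complex.norm_exp_ofReal_mul_I _
    have key : ∀ w : ℕ × (ℕ → E),
        Complex.exp (((∑ j, t j * (φ w (B j)).toReal : ℝ) : ℂ) * Complex.I)
          = ∏ i ∈ Finset.range w.1, h (w.2 i) := by
      intro w
      rw [hh, ← Complex.exp_sum, ← Finset.sum_mul, ← Complex.ofReal_sum]
      congr 3
      rw [Finset.sum_comm]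
      refine Finset.sum_congr rfl fun j _ => ?_
      rw [hφB _ _ (hB j), ENNReal.toReal_sum, Finset.mul_sum]
      · refine Finset.sum_congr rfl fun i _ => ?_
        by_cases hx : w.2 i ∈ B j <;> simp [hx]
      · intro i _
        by_cases hx : w.2 i ∈ B j <;> simp [hx]
    rw [integral_map hφm.aemeasurable (by
      apply Measurable.aestronglyMeasurable; fun_prop)]
    simp_rw [key]
    have hint : Integrable (fun w : ℕ × (ℕ → E) => ∏ i ∈ Finset.range w.1, h (w.2 i)) Q := by
      refine Integrable.of_bound (C := 1) ?_ (ae_of_all _ fun w => ?_)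
      · apply Measurable.aestronglyMeasurable
        refine measurable_from_prod_countable_right fun k => ?_
        exact Finset.measurable_fun_prod (Finset.range k) fun i _ =>
          hhm.comp (measurable_pi_apply (X := fun _ : ℕ => E) i)
      · rw [norm_prod]; simp [hhn]
    rw [hQ, integral_prod _ hint]
    have : ∀ k : ℕ, ∫ x : ℕ → E, ∏ i ∈ Finset.range k, h (x i)
        ∂(Measure.infinitePi fun _ => ν) = (∫ x, h x ∂ν) ^ k := by
      intro k
      have h1 : ∀ x : ℕ → E, ∏ i ∈ Finset.range k, h (x i)
          = (fun y : (Finset.range k) → E => ∏ i, h (y i)) ((Finset.range k).restrict x) := by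
        intro x
        simp only [Finset.restrict]
        exact (Finset.prod_coe_sort (Finset.range k) (fun i => h (x i))).symm
      simp_rw [h1]
      rw [integral_restrict_infinitePi (X := fun _ : ℕ => E) (μ := fun _ => ν)
        (f := fun y : (Finset.range k) → E => ∏ i, h (y i)), integral_fintype_prod_eq_pow]
      · simp
      · apply Measurable.aestronglyMeasurable
        exact Finset.measurable_fun_prod _ fun i _ => hhm.comp (measurable_pi_apply i)
    simp_rw [this]
    rw [integral_pow_poissonMeasure]
    congr 1
    have hhi : Integrable h ν := Integrable.of_bound (C := 1) hhm.aestronglyMeasurable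
      (ae_of_all _ fun x => (hhn x).le)
    have h2 : ∀ x, h x - 1 = ∑ j, (B j).indicator
        (fun _ => (Complex.exp (t j * Complex.I) - 1)) x := by
      intro x
      by_cases hx : ∃ j, x ∈ B j
      · obtain ⟨j, hj⟩ := hx
        have hne : ∀ i, i ≠ j → x ∉ B i := fun i hij hi =>
          Set.disjoint_left.1 (hd hij) hi hj
        rw [Finset.sum_eq_single j (fun i _ hij => by simp [hne i hij]) (by simp), hh]
        simp only
        rw [Finset.sum_eq_single j (fun i _ hij => by simp [hne i hij]) (by simp)]
        simp [hj]
      · push Not at hx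
        simp [hh, hx]
    have h3 : (∫ x, h x ∂ν) - 1 = ∑ j, (ν.real (B j) : ℂ) *
        (Complex.exp (t j * Complex.I) - 1) := by
      have : (∫ x, h x ∂ν) - 1 = ∫ x, (h x - 1) ∂ν := by
        rw [integral_sub hhi (integrable_const _)]; simp
      rw [this]
      simp_rw [h2]
      rw [integral_finsetSum _ fun j _ => (integrable_const _).indicator (hB j)]
      refine Finset.sum_congr rfl fun j _ => ?_
      rw [integral_indicator_const _ (hB j), Complex.real_smul]
    rw [h3, Finset.mul_sum]
    refine Finset.sum_congr rfl fun j _ => ?_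
    rw [← mul_assoc]
    congr 1
    rw [hνΛ]
    simp [Measure.real]

/-- `P` is the law of a Poisson point process with intensity measure `Λ`, the realizations of the
process being viewed as (counting) measures `N` on the state space. -/
structure IsPoissonProcessLaw {E : Type*} [MeasurableSpace E] (Λ : Measure E)
    (P : Measure (Measure E)) : Prop where
  isProbabilityMeasure : IsProbabilityMeasure P
  map_eval : ∀ B : Set E, MeasurableSet B → Λ B ≠ ∞ →
    P.map (fun N => N B) = (poissonMeasure (Λ B).toNNReal).map (fun k : ℕ => (k : ℝ≥0∞))
  iIndepFun_eval : ∀ (m : ℕ) (B : Fin m → Set E), (∀ j, MeasurableSet (B j)) →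
    (∀ j, Λ (B j) ≠ ∞) → Pairwise (Function.onFun Disjoint B) →
    iIndepFun (fun j (N : Measure E) => N (B j)) P

theorem exists_poisson_charFun {E : Type*} [MeasurableSpace E] (Λ : Measure E) [SFinite Λ] :
    ∃ P : Measure (Measure E), IsProbabilityMeasure P ∧
      (∀ B, MeasurableSet B → ∫⁻ N, N B ∂P = Λ B) ∧
      ∀ (m : ℕ) (B : Fin m → Set E), (∀ j, MeasurableSet (B j)) → (∀ j, Λ (B j) ≠ ∞) →
        Pairwise (Function.onFun Disjoint B) → ∀ t : Fin m → ℝ,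
        ∫ N, Complex.exp (((∑ j, t j * (N (B j)).toReal : ℝ) : ℂ) * Complex.I) ∂P =
          Complex.exp (∑ j, ((Λ (B j)).toReal : ℂ) * (Complex.exp (t j * Complex.I) - 1)) := by
  choose P hP hPm hPc using fun i => exists_poisson_charFun_of_isFiniteMeasure (sfiniteSeq Λ i)
  set Q : Measure (ℕ → Measure E) := Measure.infinitePi P with hQ
  have hsm : Measurable (fun w : ℕ → Measure E => Measure.sum w) := by
    refine Measure.measurable_of_measurable_coe _ fun B hB => ?_
    simp_rw [Measure.sum_apply _ hB]
    exact Measurable.tsum fun i => (Measure.measurable_coe hB).comp (measurable_pi_apply i)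
  have hmean : ∀ B, MeasurableSet B → ∫⁻ w, Measure.sum w B ∂Q = Λ B := by
    intro B hB
    simp_rw [Measure.sum_apply _ hB]
    rw [lintegral_tsum (f := fun i (w : ℕ → Measure E) => w i B) fun i =>
      ((Measure.measurable_coe hB).comp (measurable_pi_apply i)).aemeasurable]
    have : ∀ i, ∫⁻ w : ℕ → Measure E, w i B ∂Q = sfiniteSeq Λ i B := by
      intro i
      rw [← hPm i B hB]
      exact (measurePreserving_eval_infinitePi P i).lintegral_comp (Measure.measurable_coe hB)
    simp_rw [this]
    rw [← Measure.sum_apply _ hB, sum_sfiniteSeq]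
  refine ⟨Q.map (fun w => Measure.sum w), Measure.isProbabilityMeasure_map hsm.aemeasurable,
    fun B hB => ?_, fun m B hB hBf hd t => ?_⟩
  · rw [lintegral_map (Measure.measurable_coe hB) hsm, hmean B hB]
  have hmB : ∀ j, Measurable fun N : Measure E => (N (B j)).toReal :=
    fun j => (Measure.measurable_coe (hB j)).ennreal_toReal
  set F : Measure E → ℂ := fun N =>
    Complex.exp (((∑ j, t j * (N (B j)).toReal : ℝ) : ℂ) * Complex.I) with hF
  have hFm : Measurable F := by fun_prop
  rw [integral_map hsm.aemeasurable hFm.aestronglyMeasurable]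
  have hfin : ∀ᵐ w ∂Q, ∀ j, ∑' i, w i (B j) ≠ ∞ := by
    rw [ae_all_iff]
    intro j
    have h1 := ae_lt_top ((Measure.measurable_coe (hB j)).comp hsm)
      (by simpa using (hmean (B j) (hB j)).trans_ne (hBf j))
    filter_upwards [h1] with w hw
    rw [← Measure.sum_apply _ (hB j)]
    exact hw.ne
  have hlim1 : Tendsto (fun n => ∫ w, ∏ i ∈ Finset.range n, F (w i) ∂Q) atTop
      (𝓝 (∫ w, F (Measure.sum w) ∂Q)) := by
    refine tendsto_integral_of_dominated_convergence (fun _ => 1) (fun n => ?_)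
      (integrable_const _) (fun n => ae_of_all _ fun w => ?_) ?_
    · exact (Finset.measurable_fun_prod (Finset.range n) fun i _ =>
        hFm.comp (measurable_pi_apply i)).aestronglyMeasurable
    · rw [norm_prod]
      simp only [hF, Complex.norm_exp_ofReal_mul_I, Finset.prod_const_one, le_refl]
    · filter_upwards [hfin] with w hw
      have hs : ∀ j, Tendsto (fun n => ∑ i ∈ Finset.range n, (w i (B j)).toReal) atTop
          (𝓝 (Measure.sum w (B j)).toReal) := by
        intro j
        rw [Measure.sum_apply _ (hB j), ENNReal.tsum_toReal_eq (ENNReal.ne_top_of_tsum_ne_top (hw j))]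
        exact (ENNReal.summable_toReal (hw j)).hasSum.tendsto_sum_nat
      have hs2 : Tendsto (fun n => ∑ j, t j * ∑ i ∈ Finset.range n, (w i (B j)).toReal) atTop
          (𝓝 (∑ j, t j * (Measure.sum w (B j)).toReal)) :=
        tendsto_finsetSum _ fun j _ => (hs j).const_mul _
      have hc : Continuous fun x : ℝ => Complex.exp ((x : ℂ) * Complex.I) := by fun_prop
      refine ((hc.tendsto _).comp hs2).congr fun n => ?_
      simp only [Function.comp, hF]
      rw [← Complex.exp_sum, ← Finset.sum_mul, ← Complex.ofReal_sum]
      congr 3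
      rw [Finset.sum_comm]
      simp_rw [Finset.mul_sum]
  have hprod : ∀ n, ∫ w, ∏ i ∈ Finset.range n, F (w i) ∂Q =
      Complex.exp (∑ i ∈ Finset.range n, ∑ j, ((sfiniteSeq Λ i (B j)).toReal : ℂ) *
        (Complex.exp (t j * Complex.I) - 1)) := by
    intro n
    have h1 : ∀ w : ℕ → Measure E, ∏ i ∈ Finset.range n, F (w i)
        = (fun y : (Finset.range n) → Measure E => ∏ i, F (y i)) ((Finset.range n).restrict w) := by
      intro w
      simp only [Finset.restrict]
      exact (Finset.prod_coe_sort (Finset.range n) (fun i => F (w i))).symm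
    simp_rw [h1]
    rw [hQ, integral_restrict_infinitePi (X := fun _ : ℕ => Measure E) (μ := P)
      (f := fun y : (Finset.range n) → Measure E => ∏ i, F (y i)),
      integral_fintype_prod_eq_prod (fun _ => F)]
    · rw [Complex.exp_sum]
      refine Eq.trans ?_ (Finset.prod_coe_sort (Finset.range n) fun i => Complex.exp
        (∑ j, ((sfiniteSeq Λ i (B j)).toReal : ℂ) * (Complex.exp (t j * Complex.I) - 1)))
      exact Finset.prod_congr rfl fun i _ => hPc i m B hB hd t
    · apply Measurable.aestronglyMeasurable
      exact Finset.measurable_fun_prod _ fun i _ => hFm.comp (measurable_pi_apply i)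
  have hlim2 : Tendsto (fun n => ∫ w, ∏ i ∈ Finset.range n, F (w i) ∂Q) atTop
      (𝓝 (Complex.exp (∑ j, ((Λ (B j)).toReal : ℂ) * (Complex.exp (t j * Complex.I) - 1)))) := by
    simp_rw [hprod]
    refine (Complex.continuous_exp.tendsto _).comp ?_
    simp_rw [Finset.sum_comm (s := Finset.range _)]
    refine tendsto_finsetSum _ fun j _ => ?_
    simp_rw [← Finset.sum_mul]
    refine Tendsto.mul_const _ ?_
    have hj : ∑' i, sfiniteSeq Λ i (B j) = Λ (B j) := by
      rw [← Measure.sum_apply _ (hB j), sum_sfiniteSeq]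
    have hj' : ∑' i, sfiniteSeq Λ i (B j) ≠ ∞ := hj ▸ hBf j
    have : Tendsto (fun n => ∑ i ∈ Finset.range n, (sfiniteSeq Λ i (B j)).toReal) atTop
        (𝓝 (Λ (B j)).toReal) := by
      rw [← hj, ENNReal.tsum_toReal_eq (ENNReal.ne_top_of_tsum_ne_top hj')]
      exact (ENNReal.summable_toReal hj').hasSum.tendsto_sum_nat
    have h2 := (Complex.continuous_ofReal.tendsto _).comp this
    refine h2.congr fun n => ?_
    simp
  exact tendsto_nhds_unique hlim1 hlim2

/-- A Poisson point process exists for every s-finite intensity measure. -/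
theorem exists_isPoissonProcessLaw {E : Type*} [MeasurableSpace E] (Λ : Measure E) [SFinite Λ] :
    ∃ P : Measure (Measure E), IsPoissonProcessLaw Λ P := by
  obtain ⟨P, hP, hmean, hchar⟩ := exists_poisson_charFun Λ
  have hmB : ∀ B : Set E, MeasurableSet B → Measurable fun N : Measure E => (N B).toReal :=
    fun B hB => (Measure.measurable_coe hB).ennreal_toReal
  have hfin : ∀ B : Set E, MeasurableSet B → Λ B ≠ ∞ → ∀ᵐ N ∂P, N B ≠ ∞ := by
    intro B hB hBf
    filter_upwards [ae_lt_top (Measure.measurable_coe hB) ((hmean B hB).trans_ne hBf)] with N hN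
    exact hN.ne
  have hlaw : ∀ B : Set E, MeasurableSet B → Λ B ≠ ∞ →
      P.map (fun N => (N B).toReal) =
        (poissonMeasure (Λ B).toNNReal).map (fun k : ℕ => (k : ℝ)) := by
    intro B hB hBf
    have := Measure.isProbabilityMeasure_map (μ := P) (hmB B hB).aemeasurable
    refine Measure.ext_of_charFun (funext fun s => ?_)
    rw [charFun_map_cast_poissonMeasure, charFun_apply_real,
      integral_map (hmB B hB).aemeasurable (by fun_prop)]
    have := hchar 1 (fun _ => B) (fun _ => hB) (fun _ => hBf)
      (fun i j hij => absurd (Subsingleton.elim i j) hij) (fun _ => s)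
    simpa [ENNReal.coe_toNNReal_eq_toReal] using this
  refine ⟨P, hP, fun B hB hBf => ?_, fun m B hB hBf hd => ?_⟩
  · have h1 : P.map (fun N => N B) = (P.map (fun N => (N B).toReal)).map ENNReal.ofReal := by
      rw [Measure.map_map (by fun_prop) (hmB B hB)]
      refine Measure.map_congr ?_
      filter_upwards [hfin B hB hBf] with N hN
      simp [ENNReal.ofReal_toReal hN]
    rw [h1, hlaw B hB hBf, Measure.map_map (by fun_prop) (by fun_prop)]
    congr 1
    funext k
    simp
  · have hr : iIndepFun (fun j (N : Measure E) => (N (B j)).toReal) P := by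
      rw [iIndepFun_iff_charFun_pi fun j => (hmB _ (hB j)).aemeasurable]
      intro t
      have hmv : Measurable fun N : Measure E =>
          (WithLp.toLp 2 fun j => (N (B j)).toReal : PiLp 2 fun _ : Fin m => ℝ) :=
        (WithLp.measurable_toLp 2 (Fin m → ℝ)).comp
          (measurable_pi_lambda _ fun j => hmB _ (hB j))
      rw [charFun_apply, integral_map hmv.aemeasurable (by fun_prop)]
      simp_rw [hlaw _ (hB _) (hBf _), charFun_map_cast_poissonMeasure]
      have := hchar m B hB hBf hd t
      rw [← Complex.exp_sum]
      simp only [← ENNReal.coe_toNNReal_eq_toReal] at this ⊢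
      simpa [PiLp.inner_apply] using this
    have := hr.comp (fun _ => ENNReal.ofReal) (fun _ => by fun_prop)
    refine this.congr fun j => ?_
    filter_upwards [hfin _ (hB j) (hBf j)] with N hN
    simp [ENNReal.ofReal_toReal hN]

theorem measurable_poissonMeasure : Measurable poissonMeasure := by
  refine Measure.measurable_of_measurable_coe _ fun s hs => ?_
  simp_rw [poissonMeasure, Measure.sum_apply _ hs, Measure.smul_apply, smul_eq_mul]
  fun_prop

theorem measurable_isPoissonProcessLaw {T E : Type*} [MeasurableSpace T] [MeasurableSpace E]
    {Λ : T → Measure E} {P : T → Measure (Measure E)} (h : ∀ θ, IsPoissonProcessLaw (Λ θ) (P θ))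
    {K : ℕ → Set E} (hK : ∀ r, MeasurableSet (K r)) (hmono : Monotone K)
    (huniv : ⋃ r, K r = Set.univ) (hfin : ∀ θ r, Λ θ (K r) ≠ ∞)
    (hmeas : ∀ B r, MeasurableSet B → B ⊆ K r → Measurable fun θ => Λ θ B) : Measurable P := by
  classical
  have hprob : ∀ θ, IsProbabilityMeasure (P θ) := fun θ => (h θ).isProbabilityMeasure
  let S : Set (Set (Measure E)) := {s | ∃ F : Finset (Set E × Set ℝ≥0∞), ∃ r,
    (∀ p ∈ F, MeasurableSet p.1 ∧ p.1 ⊆ K r ∧ MeasurableSet p.2) ∧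
    s = {N | ∀ p ∈ F, N p.1 ∈ p.2}}
  refine Measurable.measure_of_isPiSystem_of_isProbabilityMeasure (S := S) ?_ ?_ ?_
  · apply le_antisymm
    · have key : ∀ B, MeasurableSet B →
          Measurable[MeasurableSpace.generateFrom S] fun N : Measure E => N B := by
        intro B hB
        have h1 : (fun N : Measure E => N B) = fun N => ⨆ r, N (B ∩ K r) := by
          funext N
          rw [← Monotone.measure_iUnion fun i j hij => Set.inter_subset_inter_right _ (hmono hij),
            ← Set.inter_iUnion, huniv, Set.inter_univ]
        rw [h1]
        refine Measurable.iSup fun r => ?_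
        intro C hC
        refine MeasurableSpace.measurableSet_generateFrom ⟨{(B ∩ K r, C)}, r, ?_, ?_⟩
        · simp only [Finset.mem_singleton, forall_eq]
          exact ⟨hB.inter (hK r), Set.inter_subset_right, hC⟩
        · ext N; simp
      have := @Measure.measurable_of_measurable_coe E (Measure E) _
        (MeasurableSpace.generateFrom S) id key
      intro s hs
      exact this hs
    · refine MeasurableSpace.generateFrom_le ?_
      rintro s ⟨F, r, hF, rfl⟩
      have : {N : Measure E | ∀ p ∈ F, N p.1 ∈ p.2} =
          ⋂ p ∈ F, (fun N : Measure E => N p.1) ⁻¹' p.2 := by ext N; simp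
      rw [this]
      exact Finset.measurableSet_biInter _ fun p hp =>
        Measure.measurable_coe (hF p hp).1 (hF p hp).2.2
  · rintro s ⟨F, r, hF, rfl⟩ s' ⟨F', r', hF', rfl⟩ -
    refine ⟨F ∪ F', max r r', ?_, ?_⟩
    · intro p hp
      rcases Finset.mem_union.1 hp with hp | hp
      · exact ⟨(hF p hp).1, (hF p hp).2.1.trans (hmono (le_max_left _ _)), (hF p hp).2.2⟩
      · exact ⟨(hF' p hp).1, (hF' p hp).2.1.trans (hmono (le_max_right _ _)), (hF' p hp).2.2⟩
    · ext N
      simp only [Set.mem_inter_iff, Set.mem_ofPred_eq, Finset.mem_union]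
      constructor
      · rintro ⟨h1, h2⟩ p (hp | hp)
        exacts [h1 p hp, h2 p hp]
      · exact fun h => ⟨fun p hp => h p (Or.inl hp), fun p hp => h p (Or.inr hp)⟩
  · rintro s ⟨F, r, hF, rfl⟩
    let e := Fintype.equivFin (F → Bool)
    let A : (F → Bool) → Set E := fun σ => K r ∩ ⋂ p : F, if σ p then p.1.1 else p.1.1ᶜ
    have hA : ∀ σ, MeasurableSet (A σ) := by
      intro σ
      refine (hK r).inter (MeasurableSet.iInter fun p => ?_)
      split_ifs
      exacts [(hF p p.2).1, (hF p p.2).1.compl]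
    have hAK : ∀ σ, A σ ⊆ K r := fun σ => Set.inter_subset_left
    have hAd : Pairwise (Function.onFun Disjoint A) := by
      intro σ τ hστ
      obtain ⟨p, hp⟩ := Function.ne_iff.1 hστ
      refine Set.disjoint_left.2 fun x hx hy => ?_
      have h1 := Set.mem_iInter.1 hx.2 p
      have h2 := Set.mem_iInter.1 hy.2 p
      cases hs : σ p <;> cases ht : τ p <;> simp_all
    have hpA : ∀ (N : Measure E) (p : F), N p.1.1 = ∑ σ : F → Bool, if σ p then N (A σ) else 0 := by
      intro N p
      rw [← Finset.sum_filter, ← measure_biUnion_finset (fun σ _ τ _ hne => hAd hne)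
        (fun σ _ => hA σ)]
      congr 1
      ext x
      simp only [Finset.mem_filter, Finset.mem_univ, true_and, Set.mem_iUnion, exists_prop]
      constructor
      · intro hx
        refine ⟨fun q => decide (x ∈ q.1.1), by simpa using hx, (hF p p.2).2.1 hx, ?_⟩
        refine Set.mem_iInter.2 fun q => ?_
        by_cases hq : x ∈ q.1.1 <;> simp [hq]
      · rintro ⟨σ, hσ, -, hx⟩
        have := Set.mem_iInter.1 hx p
        simpa [hσ] using this
    let C : Set (Fin (Fintype.card (F → Bool)) → ℝ≥0∞) :=
      {v | ∀ p : F, (∑ σ : F → Bool, if σ p then v (e σ) else 0) ∈ p.1.2}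
    have hC : MeasurableSet C := by
      have : C = ⋂ p : F, (fun v : Fin (Fintype.card (F → Bool)) → ℝ≥0∞ =>
          ∑ σ : F → Bool, if σ p then v (e σ) else 0) ⁻¹' p.1.2 := by ext v; simp [C]
      rw [this]
      refine MeasurableSet.iInter fun p => ?_
      refine (Finset.measurable_fun_sum _ fun σ _ => ?_) (hF p p.2).2.2
      split_ifs <;> fun_prop
    have hev : Measurable fun (N : Measure E) j => N (A (e.symm j)) :=
      measurable_pi_lambda _ fun j => Measure.measurable_coe (hA _)
    have hset : {N : Measure E | ∀ p ∈ F, N p.1 ∈ p.2} =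
        (fun (N : Measure E) j => N (A (e.symm j))) ⁻¹' C := by
      ext N
      simp only [Set.mem_ofPred_eq, Set.mem_preimage, C, Equiv.symm_apply_apply]
      simp_rw [← hpA]
      exact ⟨fun h p => h p p.2, fun h p hp => h ⟨p, hp⟩⟩
    have hAf : ∀ θ σ, Λ θ (A σ) ≠ ∞ := fun θ σ =>
      ((measure_mono (hAK σ)).trans_lt (hfin θ r).lt_top).ne
    have hmap : ∀ θ, P θ {N : Measure E | ∀ p ∈ F, N p.1 ∈ p.2} =
        Measure.pi (fun j => (poissonMeasure (Λ θ (A (e.symm j))).toNNReal).map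
          (fun k : ℕ => (k : ℝ≥0∞))) C := by
      intro θ
      rw [hset, ← Measure.map_apply hev hC]
      have hi := (h θ).iIndepFun_eval _ (fun j => A (e.symm j)) (fun j => hA _)
        (fun j => hAf θ _) (fun i j hij => hAd (e.symm.injective.ne hij))
      rw [(iIndepFun_iff_map_fun_eq_pi_map fun j =>
        (Measure.measurable_coe (hA (e.symm j))).aemeasurable).1 hi]
      simp_rw [(h θ).map_eval _ (hA _) (hAf θ _)]
    simp_rw [hmap]
    have hμ : ∀ j, Measurable fun θ => (poissonMeasure (Λ θ (A (e.symm j))).toNNReal).map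
        (fun k : ℕ => (k : ℝ≥0∞)) := fun j =>
      (Measure.measurable_map _ (by fun_prop)).comp
        (measurable_poissonMeasure.comp (hmeas _ r (hA _) (hAK _)).ennreal_toNNReal)
    have hpi : Measurable fun θ => Measure.pi (fun j =>
        (poissonMeasure (Λ θ (A (e.symm j))).toNNReal).map (fun k : ℕ => (k : ℝ≥0∞))) := by
      refine Measurable.measure_of_isPiSystem_of_isProbabilityMeasure generateFrom_pi.symm
        isPiSystem_pi ?_
      rintro _ ⟨t, ht, rfl⟩
      simp_rw [Measure.pi_pi]
      exact Finset.measurable_fun_prod _ fun j _ =>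
        (Measure.measurable_coe (show MeasurableSet (t j) from ht j (Set.mem_univ j))).comp (hμ j)
    exact (Measure.measurable_coe hC).comp hpi

/-- The parameter space `L¹([0,1])` of boundary functions (with the almost everywhere order and the
`L¹`-norm). -/
abbrev BoundaryFunction : Type := Lp ℝ 1 (volume : Measure unitInterval)

/-- The intensity measure on `[0,1] × ℝ` with Lebesgue density `(x, y) ↦ n 𝟙(f x ≤ y)`. -/
noncomputable def boundaryIntensity (n : ℕ) (f : BoundaryFunction) : Measure (unitInterval × ℝ) :=
  (volume : Measure (unitInterval × ℝ)).withDensity ({p | f p.1 ≤ p.2}.indicator fun _ => (n : ℝ≥0∞))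

theorem measurableSet_epigraph (f : BoundaryFunction) :
    MeasurableSet {p : unitInterval × ℝ | f p.1 ≤ p.2} :=
  measurableSet_le ((Lp.stronglyMeasurable f).measurable.comp measurable_fst) measurable_snd

theorem boundaryIntensity_apply (n : ℕ) (f : BoundaryFunction) {B : Set (unitInterval × ℝ)}
    (hB : MeasurableSet B) :
    boundaryIntensity n f B = n * (volume : Measure (unitInterval × ℝ)) ({p | f p.1 ≤ p.2} ∩ B) := by
  rw [boundaryIntensity, withDensity_apply _ hB, lintegral_indicator (measurableSet_epigraph f),
    setLIntegral_const, Measure.restrict_apply (measurableSet_epigraph f)]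

theorem volume_between (g : unitInterval → ℝ) (hg : Measurable g) (f : unitInterval → ℝ) (hf : Measurable f) :
    (volume : Measure (unitInterval × ℝ)) {p | f p.1 ≤ p.2 ∧ p.2 ≤ g p.1} =
      ∫⁻ x, ENNReal.ofReal (g x - f x) := by
  rw [Measure.volume_eq_prod, Measure.prod_apply]
  · refine lintegral_congr fun x => ?_
    rw [← Real.volume_Icc]
    rfl
  · exact (measurableSet_le (hf.comp measurable_fst) measurable_snd).inter
      (measurableSet_le measurable_snd (hg.comp measurable_fst))

theorem boundaryIntensity_window_ne_top (n : ℕ) (f : BoundaryFunction) (r : ℝ) :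
    boundaryIntensity n f {p | p.2 ≤ r} ≠ ∞ := by
  rw [boundaryIntensity_apply n f (measurableSet_le measurable_snd measurable_const)]
  refine ENNReal.mul_ne_top (ENNReal.natCast_ne_top n) ?_
  have := volume_between (fun _ => r) measurable_const f (Lp.stronglyMeasurable f).measurable
  rw [show {p : unitInterval × ℝ | f p.1 ≤ p.2} ∩ {p | p.2 ≤ r} = {p | f p.1 ≤ p.2 ∧ p.2 ≤ r} from rfl, this]
  have hi : Integrable (fun x => r - f x) (volume : Measure unitInterval) :=
    (integrable_const r).sub (L1.integrable_coeFn f)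
  refine ((lintegral_mono fun x => ?_).trans_lt hi.2).ne
  exact Real.ofReal_le_enorm _

theorem boundaryIntensity_le_add (n : ℕ) (f g : BoundaryFunction) {B : Set (unitInterval × ℝ)}
    (hB : MeasurableSet B) :
    boundaryIntensity n f B ≤ boundaryIntensity n g B + n * ENNReal.ofReal ‖f - g‖ := by
  rw [boundaryIntensity_apply n f hB, boundaryIntensity_apply n g hB, ← mul_add]
  gcongr
  have hsub : {p : unitInterval × ℝ | f p.1 ≤ p.2} ∩ B ⊆
      ({p | g p.1 ≤ p.2} ∩ B) ∪ {p | f p.1 ≤ p.2 ∧ p.2 ≤ g p.1} := by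
    rintro p ⟨hp, hpB⟩
    rcases le_total (g p.1) p.2 with h | h
    exacts [Or.inl ⟨h, hpB⟩, Or.inr ⟨hp, h⟩]
  refine (measure_mono hsub).trans ((measure_union_le _ _).trans ?_)
  gcongr
  rw [volume_between g (Lp.stronglyMeasurable g).measurable f (Lp.stronglyMeasurable f).measurable,
    L1.ofReal_norm_sub_eq_lintegral]
  refine lintegral_mono fun x => ?_
  rw [← enorm_neg, neg_sub]
  exact Real.ofReal_le_enorm _

theorem continuous_boundaryIntensity (n : ℕ) {B : Set (unitInterval × ℝ)} (hB : MeasurableSet B) :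
    Continuous fun f : BoundaryFunction => boundaryIntensity n f B := by
  refine continuous_iff_continuousAt.2 fun g => ?_
  have h0 : Tendsto (fun f : BoundaryFunction => (n : ℝ≥0∞) * ENNReal.ofReal ‖f - g‖) (𝓝 g)
      (𝓝 0) := by
    have h1 : Tendsto (fun f : BoundaryFunction => ENNReal.ofReal ‖f - g‖) (𝓝 g) (𝓝 0) := by
      have : Continuous fun f : BoundaryFunction => ENNReal.ofReal ‖f - g‖ :=
        ENNReal.continuous_ofReal.comp (continuous_id.sub continuous_const).norm
      simpa using this.tendsto g
    simpa using ENNReal.Tendsto.const_mul h1 (Or.inr (ENNReal.natCast_ne_top n))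
  refine tendsto_of_tendsto_of_tendsto_of_le_of_le
    (g := fun f : BoundaryFunction => boundaryIntensity n g B - n * ENNReal.ofReal ‖f - g‖)
    (h := fun f : BoundaryFunction => boundaryIntensity n g B + n * ENNReal.ofReal ‖f - g‖)
    ?_ ?_ (fun f => ?_) (fun f => boundaryIntensity_le_add n f g hB)
  · simpa using ENNReal.Tendsto.sub (tendsto_const_nhds (x := boundaryIntensity n g B)) h0
      (Or.inr ENNReal.zero_ne_top)
  · simpa using (tendsto_const_nhds (x := boundaryIntensity n g B)).add h0
  · have := boundaryIntensity_le_add n g f hB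
    rw [norm_sub_rev] at this
    exact tsub_le_iff_right.2 this

instance (n : ℕ) (f : BoundaryFunction) : SFinite (boundaryIntensity n f) := by
  unfold boundaryIntensity
  infer_instance

/-- The law `P_f = P_fⁿ` of the Poisson point process with intensity `n 𝟙(f x ≤ y)`, a probability
measure on the space of measures on `[0,1] × ℝ`. -/
noncomputable def boundaryLaw (n : ℕ) (f : BoundaryFunction) : Measure (Measure (unitInterval × ℝ)) :=
  (exists_isPoissonProcessLaw (boundaryIntensity n f)).choose

theorem isPoissonProcessLaw_boundaryLaw (n : ℕ) (f : BoundaryFunction) :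
    IsPoissonProcessLaw (boundaryIntensity n f) (boundaryLaw n f) :=
  (exists_isPoissonProcessLaw (boundaryIntensity n f)).choose_spec

instance (n : ℕ) (f : BoundaryFunction) : IsProbabilityMeasure (boundaryLaw n f) :=
  (isPoissonProcessLaw_boundaryLaw n f).isProbabilityMeasure

/-- The statistical model `θ ↦ P_{ι θ}`, where the parameter space `Θ` is mapped continuously into
`L¹([0,1])` by `ι`. -/
noncomputable def boundaryModel {Θ : Type*} [TopologicalSpace Θ] [MeasurableSpace Θ]
    [BorelSpace Θ] (n : ℕ) (ι : Θ → BoundaryFunction) (hι : Continuous ι) :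
    Kernel Θ (Measure (unitInterval × ℝ)) where
  toFun θ := boundaryLaw n (ι θ)
  measurable' := by
    refine measurable_isPoissonProcessLaw (K := fun r : ℕ => {p | p.2 ≤ (r : ℝ)})
      (fun θ => isPoissonProcessLaw_boundaryLaw n (ι θ))
      (fun r => measurableSet_le measurable_snd measurable_const)
      (fun r s hrs p (hp : p.2 ≤ (r : ℝ)) => hp.trans (Nat.cast_le.2 hrs)) ?_
      (fun θ r => boundaryIntensity_window_ne_top n (ι θ) r)
      (fun B r hB _ => ((continuous_boundaryIntensity n hB).comp hι).measurable)
    refine Set.eq_univ_of_forall fun p => Set.mem_iUnion.2 ?_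
    exact exists_nat_ge p.2

instance {Θ : Type*} [TopologicalSpace Θ] [MeasurableSpace Θ] [BorelSpace Θ] (n : ℕ)
    (ι : Θ → BoundaryFunction) (hι : Continuous ι) : IsMarkovKernel (boundaryModel n ι hι) :=
  ⟨fun θ => inferInstanceAs (IsProbabilityMeasure (boundaryLaw n (ι θ)))⟩

/-- The covering number `N(δ, F, ‖·‖_∞)`: the smallest number of closed `‖·‖_∞`-balls of radius `δ`
(with centers not necessarily in `F`) that cover `F`; it is `⊤` if there is no finite cover. -/
noncomputable def coveringNumberSup (δ : ℝ) (F : Set BoundaryFunction) : ℕ∞ :=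
  ⨅ (s : Finset BoundaryFunction)
    (_ : ∀ f ∈ F, ∃ g ∈ s, eLpNorm (f - g) ∞ (volume : Measure unitInterval) ≤ ENNReal.ofReal δ),
    (s.card : ℕ∞)

/-- The one-sided bracketing number `N_[(δ, F)`: the smallest number of functions `ℓ` in
`L¹([0,1])` such that every `f ∈ F` has some `ℓ ≤ f` with `∫ (f - ℓ) ≤ δ`. -/
noncomputable def bracketingNumberLower (δ : ℝ) (F : Set BoundaryFunction) : ℕ∞ :=
  ⨅ (s : Finset BoundaryFunction)
    (_ : ∀ f ∈ F, ∃ l ∈ s, l ≤ f ∧ ∫ x, (f x - l x) ≤ δ),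
    (s.card : ℕ∞)

/-- The separation quantity `S_[(n, F, f₀)`: the infimum of `∑ⱼ exp (-n ∫ (ℓⱼ - f₀)₊)` over all
countable families `(ℓⱼ)` in `L¹([0,1])` such that every `f ∈ F` lies above some `ℓⱼ`. -/
noncomputable def separationQuantity (n : ℕ) (F : Set BoundaryFunction) (f₀ : BoundaryFunction) :
    ℝ≥0∞ :=
  ⨅ (J : Set ℤ) (l : J → BoundaryFunction) (_ : ∀ f ∈ F, ∃ j, l j ≤ f),
    ∑' j, ENNReal.ofReal (Real.exp (-(n * ∫ x, max (l j x - f₀ x) 0)))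

/-! The proof rests on an exact conditioning property. If `f ≤ g`, a process with law `P_f`
conditioned to have no point strictly below `g` has law `P_g` (`boundaryLaw_eq_cond`). The
conditioning event has `P_f`-probability `exp (-n ∫ (g - f)₊)`, so `P_g ≤ exp (n ‖f - g‖) • P_f`.
Averaging over the one-sided small ball bounds `P_{f₀}` by `exp ((A + C) n ε)` times the marginal
law of the data (`boundaryLaw_le_smul_marginal`).

By Bayes' formula, for an event `T` the `P_{f₀}`-integral over `T` of the posterior mass of `V` is
then at most this factor times `∫_V P_θ(T) dΠ` (`setLIntegral_posterior_le`).

Since `‖f - f₀‖` is the sum of the integrals of `(f - f₀)₊` and `(f₀ - f)₊`, three sets of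
parameters have to be controlled. Outside the sieve, the prior mass absorbs the factor. For
functions falling far below `f₀`, take for `T` the event of no point below `f₀`: it has full
`P_{f₀}`-probability and is exponentially unlikely under `P_θ`. For functions rising far above `f₀`,
test whether some lower bracket `ℓ_j` has no point below it: this is unlikely under `P_{f₀}` by a
union bound, and almost sure under `P_θ` once `ℓ_j ≤ θ`. The last bound is the sum defining
`separationQuantity`, which is estimated through bracketing or covering numbers. -/

namespace IsPoissonProcessLaw

/-! ### Poisson processes: void probabilities, uniqueness, conditioning on a void. -/

variable {E : Type*} [MeasurableSpace E] {Λ : Measure E} {P P' : Measure (Measure E)}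

theorem measure_eval_mem (h : IsPoissonProcessLaw Λ P) {B : Set E} (hB : MeasurableSet B)
    (hBf : Λ B ≠ ∞) {C : Set ℝ≥0∞} (hC : MeasurableSet C) :
    P {N | N B ∈ C} =
      (poissonMeasure (Λ B).toNNReal).map (fun k : ℕ => (k : ℝ≥0∞)) C := by
  rw [← h.map_eval B hB hBf, Measure.map_apply (Measure.measurable_coe hB) hC]
  rfl

/-- The probability that a Poisson point process has no point in `B`. -/
theorem measure_eval_eq_zero (h : IsPoissonProcessLaw Λ P) {B : Set E} (hB : MeasurableSet B)
    (hBf : Λ B ≠ ∞) : P {N | N B = 0} = ENNReal.ofReal (Real.exp (-(Λ B).toReal)) := by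
  have h1 := h.measure_eval_mem hB hBf (measurableSet_singleton 0)
  have h2 : (fun k : ℕ => (k : ℝ≥0∞)) ⁻¹' {0} = {0} := by ext k; simp
  rw [Measure.map_apply (by fun_prop) (measurableSet_singleton 0), h2, poissonMeasure_singleton]
    at h1
  simpa [ENNReal.coe_toNNReal_eq_toReal] using h1

/-- The law of a Poisson point process is determined by its intensity. -/
theorem eq_of_exhaustion (h : IsPoissonProcessLaw Λ P)
    (h' : IsPoissonProcessLaw Λ P') {K : ℕ → Set E} (hK : ∀ r, MeasurableSet (K r))
    (hmono : Monotone K) (huniv : ⋃ r, K r = Set.univ) (hfin : ∀ r, Λ (K r) ≠ ∞) : P = P' := by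
  -- With the trivial σ-algebra on `Bool`, measurable real-valued maps are constant. Measurability
  -- of Poisson laws in their parameter, applied to a constant intensity, therefore forces the two
  -- laws to agree.
  let _ : MeasurableSpace Bool := ⊥
  have hm : Measurable (fun b : Bool => if b then P else P') :=
    measurable_isPoissonProcessLaw (Λ := fun _ => Λ) (fun b => by cases b <;> simpa)
      hK hmono huniv (fun _ => hfin) (fun _ _ _ _ => measurable_const)
  ext D hD
  have h1 : Measurable (fun b : Bool => (if b then P else P') D) :=
    (Measure.measurable_coe hD).comp hm
  have h2 := MeasurableSpace.measurableSet_bot_iff.1 (h1 (measurableSet_singleton (P D)))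
  have h3 : true ∈ (fun b : Bool => (if b then P else P') D) ⁻¹' {P D} := by simp
  rcases h2 with h2 | h2
  · rw [h2] at h3; exact h3.elim
  · have h4 : false ∈ (fun b : Bool => (if b then P else P') D) ⁻¹' {P D} := by simp [h2]
    simpa using h4.symm

/-- When `L` is void, `N (B j) = N (B j ∩ Lᶜ)`, and the sets `L`, `B j ∩ Lᶜ` are pairwise disjoint,
so the independence of counts applies to them jointly. -/
theorem inter_measure_eval_eq_zero (h : IsPoissonProcessLaw Λ P) {L : Set E}
    (hL : MeasurableSet L) (hLf : Λ L ≠ ∞) {m : ℕ} {B : Fin m → Set E}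
    (hB : ∀ j, MeasurableSet (B j)) (hBf : ∀ j, Λ (B j ∩ Lᶜ) ≠ ∞)
    (hd : Pairwise (Function.onFun Disjoint B)) {C : Fin m → Set ℝ≥0∞}
    (hC : ∀ j, MeasurableSet (C j)) :
    P ({N | N L = 0} ∩ {N | ∀ j, N (B j) ∈ C j}) =
      P {N | N L = 0} * ∏ j, P {N | N (B j ∩ Lᶜ) ∈ C j} := by
  have hi := h.iIndepFun_eval (m + 1) (Fin.cons L fun j => B j ∩ Lᶜ)
    (Fin.cases hL fun j => (hB j).inter hL.compl) (Fin.cases hLf hBf) (by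
      intro i j hij
      induction i using Fin.cases with
      | zero =>
        induction j using Fin.cases with
        | zero => exact absurd rfl hij
        | succ j => exact Set.disjoint_left.2 fun x hx hy => hy.2 hx
      | succ i =>
        induction j using Fin.cases with
        | zero => exact Set.disjoint_left.2 fun x hx hy => hx.2 hy
        | succ j =>
          exact (hd fun hij' => hij (congrArg Fin.succ hij')).mono Set.inter_subset_left
            Set.inter_subset_left)
  have hp := (iIndepFun_iff_measure_inter_preimage_eq_mul.1 hi) Finset.univ
    (sets := Fin.cons {0} C) (fun i _ => by
      induction i using Fin.cases with
      | zero => exact measurableSet_singleton 0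
      | succ j => exact hC j)
  rw [Fin.prod_univ_succ] at hp
  refine Eq.trans ?_ (hp.trans rfl)
  congr 1
  ext N
  simp only [Set.mem_inter_iff, Set.mem_ofPred_eq, Finset.mem_univ, Set.iInter_true,
    Set.mem_iInter, Set.mem_preimage, Fin.forall_fin_succ, Fin.cons_zero, Fin.cons_succ,
    Set.mem_singleton_iff]
  refine and_congr_right fun h0 => forall_congr' fun j => ?_
  rw [← measure_inter_add_sdiff (B j) hL, measure_mono_null Set.inter_subset_right h0, zero_add]
  rfl

/-- Conditionally on having no point in `L`, a Poisson point process is a Poisson point process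
with the intensity restricted to the complement of `L`. -/
theorem cond_eval_eq_zero (h : IsPoissonProcessLaw Λ P) {L : Set E}
    (hL : MeasurableSet L) (hLf : Λ L ≠ ∞) :
    IsPoissonProcessLaw (Λ.restrict Lᶜ) (P[|{N | N L = 0}]) := by
  have := h.isProbabilityMeasure
  have hG : MeasurableSet {N : Measure E | N L = 0} :=
    Measure.measurable_coe hL (measurableSet_singleton 0)
  have hG0 : P {N | N L = 0} ≠ 0 := by
    rw [h.measure_eval_eq_zero hL hLf]
    simp [Real.exp_pos]
  -- Both the marginal laws and the independence under the conditional law are read off from this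
  -- product formula.
  have hjoint : ∀ (m : ℕ) (B : Fin m → Set E), (∀ j, MeasurableSet (B j)) →
      (∀ j, Λ.restrict Lᶜ (B j) ≠ ∞) → Pairwise (Function.onFun Disjoint B) →
      ∀ C : Fin m → Set ℝ≥0∞, (∀ j, MeasurableSet (C j)) →
      P[|{N | N L = 0}] {N | ∀ j, N (B j) ∈ C j} = ∏ j, P {N | N (B j ∩ Lᶜ) ∈ C j} := by
    intro m B hB hBf hd C hC
    rw [cond_apply hG, h.inter_measure_eval_eq_zero hL hLf hB (fun j => by
      rw [← Measure.restrict_apply (hB j)]; exact hBf j) hd hC, ← mul_assoc,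
      ENNReal.inv_mul_cancel hG0 (measure_ne_top _ _), one_mul]
  have hone : ∀ B, MeasurableSet B → Λ.restrict Lᶜ B ≠ ∞ → ∀ C : Set ℝ≥0∞, MeasurableSet C →
      P[|{N | N L = 0}] {N | N B ∈ C} = P {N | N (B ∩ Lᶜ) ∈ C} := by
    intro B hB hBf C hC
    simpa using hjoint 1 (fun _ => B) (fun _ => hB) (fun _ => hBf)
      (fun i j hij => absurd (Subsingleton.elim i j) hij) (fun _ => C) fun _ => hC
  refine ⟨cond_isProbabilityMeasure hG0, fun B hB hBf => ?_, fun m B hB hBf hd => ?_⟩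
  · ext C hC
    rw [Measure.map_apply (Measure.measurable_coe hB) hC]
    refine (hone B hB hBf C hC).trans ?_
    rw [Measure.restrict_apply hB] at hBf ⊢
    exact h.measure_eval_mem (hB.inter hL.compl) hBf hC
  · rw [iIndepFun_iff_measure_inter_preimage_eq_mul]
    classical
    intro S C hC
    -- Indices outside `S` get the trivial constraint, which contributes a factor 1.
    have h1 := hjoint m B hB hBf hd (fun j => if j ∈ S then C j else Set.univ) (fun j => by
      split_ifs with hj
      exacts [hC j hj, MeasurableSet.univ])
    have h2 : {N : Measure E | ∀ j, N (B j) ∈ (if j ∈ S then C j else Set.univ)} =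
        ⋂ j ∈ S, (fun N : Measure E => N (B j)) ⁻¹' C j := by
      ext N
      simp only [Set.mem_ofPred_eq, Set.mem_iInter, Set.mem_preimage]
      refine forall_congr' fun j => ?_
      split_ifs with hj <;> simp [hj]
    rw [h2] at h1
    rw [h1, ← Finset.prod_subset (Finset.subset_univ S)]
    · refine Finset.prod_congr rfl fun j hj => ?_
      rw [if_pos hj]
      exact (hone (B j) (hB j) (hBf j) _ (hC j hj)).symm
    · intro j _ hj
      simp [if_neg hj, h.isProbabilityMeasure.measure_univ]

end IsPoissonProcessLaw

/-! ### Boundary laws: points below a function, conditioning and domination. -/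

theorem measurableSet_hypograph (g : BoundaryFunction) :
    MeasurableSet {p : unitInterval × ℝ | p.2 < g p.1} :=
  measurableSet_lt measurable_snd ((Lp.stronglyMeasurable g).measurable.comp measurable_fst)

theorem measurableSet_noPointBelow (g : BoundaryFunction) :
    MeasurableSet {N : Measure (unitInterval × ℝ) | N {p | p.2 < g p.1} = 0} :=
  Measure.measurable_coe (measurableSet_hypograph g) (measurableSet_singleton 0)

theorem integrable_posPart_sub (g f : BoundaryFunction) :
    Integrable (fun x => max (g x - f x) 0) (volume : Measure unitInterval) :=
  ((L1.integrable_coeFn g).sub (L1.integrable_coeFn f)).pos_part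

theorem boundaryIntensity_hypograph (n : ℕ) (f g : BoundaryFunction) :
    boundaryIntensity n f {p | p.2 < g p.1} =
      ENNReal.ofReal (n * ∫ x, max (g x - f x) 0) := by
  have hS : {p : unitInterval × ℝ | f p.1 ≤ p.2} ∩ {p | p.2 < g p.1} =
      {p | f p.1 ≤ p.2 ∧ p.2 < g p.1} := rfl
  rw [boundaryIntensity_apply n f (measurableSet_hypograph g), Measure.volume_eq_prod,
    Measure.prod_apply ((measurableSet_epigraph f).inter (measurableSet_hypograph g)), hS,
    ENNReal.ofReal_mul (Nat.cast_nonneg n), ENNReal.ofReal_natCast,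
    ofReal_integral_eq_lintegral_ofReal (integrable_posPart_sub g f)
      (ae_of_all _ fun x => le_max_right _ _)]
  congr 1
  refine lintegral_congr fun x => ?_
  rw [ENNReal.ofReal_max, ENNReal.ofReal_zero, max_eq_left zero_le, ← Real.volume_Ico]
  rfl

/-- The strict inequality in the hypograph makes its complement the closed epigraph carrying the
intensity of `g`. The order `f ≤ g` holds only almost everywhere, so the sets are compared up to
null sets. -/
theorem boundaryIntensity_restrict (n : ℕ) {f g : BoundaryFunction} (hfg : f ≤ g) :
    (boundaryIntensity n f).restrict {p | p.2 < g p.1}ᶜ = boundaryIntensity n g := by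
  ext B hB
  rw [Measure.restrict_apply hB,
    boundaryIntensity_apply n f (hB.inter (measurableSet_hypograph g).compl),
    boundaryIntensity_apply n g hB]
  congr 1
  refine measure_congr ?_
  have h1 : ∀ᵐ p : unitInterval × ℝ, f p.1 ≤ g p.1 := by
    rw [Measure.volume_eq_prod]
    exact Measure.quasiMeasurePreserving_fst.ae ((Lp.coeFn_le f g).2 hfg)
  filter_upwards [h1] with p hp
  refine propext ⟨fun h => ⟨le_of_not_gt (a := g p.1) (b := p.2) h.2.2, h.2.1⟩,
    fun h => ⟨hp.trans h.1, h.2, not_lt_of_ge (show g p.1 ≤ p.2 from h.1)⟩⟩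

/-- The probability under `P_f` that no point lies strictly below `g`. -/
theorem boundaryLaw_noPointBelow (n : ℕ) (f g : BoundaryFunction) :
    boundaryLaw n f {N | N {p | p.2 < g p.1} = 0} =
      ENNReal.ofReal (Real.exp (-(n * ∫ x, max (g x - f x) 0))) := by
  rw [(isPoissonProcessLaw_boundaryLaw n f).measure_eval_eq_zero (measurableSet_hypograph g)
    (by rw [boundaryIntensity_hypograph]; exact ENNReal.ofReal_ne_top),
    boundaryIntensity_hypograph, ENNReal.toReal_ofReal]
  exact mul_nonneg (Nat.cast_nonneg n) (integral_nonneg fun x => le_max_right _ _)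

theorem integral_posPart_sub_eq_zero {f g : BoundaryFunction} (h : g ≤ f) :
    ∫ x, max (g x - f x) 0 = 0 := by
  refine integral_eq_zero_of_ae ?_
  filter_upwards [(Lp.coeFn_le g f).2 h] with x hx
  exact max_eq_right (sub_nonpos.2 hx)

theorem ae_boundaryLaw_noPointBelow (n : ℕ) {f g : BoundaryFunction} (h : g ≤ f) :
    ∀ᵐ N ∂(boundaryLaw n f), N {p | p.2 < g p.1} = 0 := by
  refine (prob_compl_eq_zero_iff (measurableSet_noPointBelow g)).2 ?_
  rw [boundaryLaw_noPointBelow, integral_posPart_sub_eq_zero h]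
  simp

/-- Conditioning removes the part of the intensity below `g`, and what remains is the intensity of
`g`. Uniqueness then identifies the two laws; the half-planes `p.2 ≤ r` are the required exhaustion
by sets of finite intensity. -/
theorem boundaryLaw_eq_cond (n : ℕ) {f g : BoundaryFunction} (hfg : f ≤ g) :
    boundaryLaw n g = (boundaryLaw n f)[|{N | N {p | p.2 < g p.1} = 0}] := by
  have h1 := (isPoissonProcessLaw_boundaryLaw n f).cond_eval_eq_zero (measurableSet_hypograph g)
    (by rw [boundaryIntensity_hypograph]; exact ENNReal.ofReal_ne_top)
  rw [boundaryIntensity_restrict n hfg] at h1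
  refine (isPoissonProcessLaw_boundaryLaw n g).eq_of_exhaustion h1
    (K := fun r : ℕ => {p | p.2 ≤ (r : ℝ)})
    (fun r => measurableSet_le measurable_snd measurable_const)
    (fun r s hrs p (hp : p.2 ≤ (r : ℝ)) => hp.trans (Nat.cast_le.2 hrs)) ?_
    (fun r => boundaryIntensity_window_ne_top n g r)
  refine Set.eq_univ_of_forall fun p => Set.mem_iUnion.2 ?_
  exact exists_nat_ge p.2

theorem integral_posPart_sub_le_norm (f g : BoundaryFunction) :
    ∫ x, max (g x - f x) 0 ≤ ‖f - g‖ := by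
  rw [norm_sub_rev, L1.norm_eq_integral_norm]
  refine integral_mono_ae (integrable_posPart_sub g f) (L1.integrable_coeFn (g - f)).norm ?_
  filter_upwards [Lp.coeFn_sub g f] with x hx
  rw [hx, Pi.sub_apply, Real.norm_eq_abs]
  exact max_le (le_abs_self _) (abs_nonneg _)

theorem norm_sub_eq_add_integral_posPart (f g : BoundaryFunction) :
    ‖f - g‖ = (∫ x, max (f x - g x) 0) + ∫ x, max (g x - f x) 0 := by
  rw [L1.norm_eq_integral_norm, ← integral_add (integrable_posPart_sub f g)
    (integrable_posPart_sub g f)]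
  refine integral_congr_ae ?_
  filter_upwards [Lp.coeFn_sub f g] with x hx
  rw [hx, Pi.sub_apply, Real.norm_eq_abs]
  rcases le_total (f x) (g x) with h | h
  · rw [abs_of_nonpos (by linarith), max_eq_right (by linarith), max_eq_left (by linarith)]; ring
  · rw [abs_of_nonneg (by linarith), max_eq_left (by linarith), max_eq_right (by linarith)]; ring

/-- The integral is the `L¹`-norm of a positive part. This makes the set of functions lying far
below `f₀` measurable. -/
theorem continuous_integral_posPart_sub (g : BoundaryFunction) :
    Continuous fun f : BoundaryFunction => ∫ x, max (g x - f x) 0 := by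
  have h1 : (fun f : BoundaryFunction => ∫ x, max (g x - f x) 0) =
      fun f => ‖Lp.posPart (g - f)‖ := by
    funext f
    rw [L1.norm_eq_integral_norm]
    refine integral_congr_ae ?_
    filter_upwards [Lp.coeFn_posPart (g - f), Lp.coeFn_sub g f] with x hx hx'
    rw [hx, hx', Pi.sub_apply, Real.norm_of_nonneg (le_max_right _ _)]
  rw [h1]
  exact (Lp.continuous_posPart.comp (continuous_const.sub continuous_id)).norm

/-- The law `P_g` is dominated by a multiple of `P_f` if `f ≤ g` are within distance `r` in `L¹`. -/
theorem boundaryLaw_le_smul (n : ℕ) {f g : BoundaryFunction} (hfg : f ≤ g) {r : ℝ}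
    (hr : ‖f - g‖ ≤ r) :
    boundaryLaw n g ≤ ENNReal.ofReal (Real.exp (n * r)) • boundaryLaw n f := by
  refine Measure.le_iff.2 fun D _ => ?_
  rw [boundaryLaw_eq_cond n hfg, cond_apply (measurableSet_noPointBelow g),
    boundaryLaw_noPointBelow, ← ENNReal.ofReal_inv_of_pos (Real.exp_pos _), ← Real.exp_neg,
    neg_neg, Measure.smul_apply, smul_eq_mul]
  gcongr
  · exact (integral_posPart_sub_le_norm f g).trans hr
  · exact Set.inter_subset_right

/-! ### Change of measure from the truth to the marginal law of the data. -/

/-- The part of the mixture coming from `B` already dominates. Markov's inequality at level `a⁻¹ * P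
D` replaces integration over `B`, so `B` need not be measurable. -/
theorem le_smul_comp_of_le_smul {Ω 𝓧 : Type*} [MeasurableSpace Ω] [MeasurableSpace 𝓧]
    {κ : Kernel Ω 𝓧} {μ : Measure Ω} [IsFiniteMeasure μ] {P : Measure 𝓧} {a : ℝ≥0∞} (ha : a ≠ 0)
    (ha' : a ≠ ∞) {B : Set Ω} (hB : μ B ≠ 0) (h : ∀ θ ∈ B, P ≤ a • κ θ) :
    P ≤ (a * (μ B)⁻¹) • (κ ∘ₘ μ) := by
  refine Measure.le_iff.2 fun D hD => ?_
  have h1 : a⁻¹ * P D * μ B ≤ (κ ∘ₘ μ) D := by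
    rw [Measure.bind_apply hD κ.aemeasurable]
    refine le_trans ?_ (mul_meas_ge_le_lintegral (κ.measurable_coe hD) (a⁻¹ * P D))
    gcongr
    intro θ hθ
    have h2 := h θ hθ D
    rw [Measure.smul_apply, smul_eq_mul] at h2
    calc a⁻¹ * P D ≤ a⁻¹ * (a * κ θ D) := by gcongr
      _ = κ θ D := by rw [← mul_assoc, ENNReal.inv_mul_cancel ha ha', one_mul]
  calc P D = a * (μ B)⁻¹ * (a⁻¹ * P D * μ B) := by
        rw [show a * (μ B)⁻¹ * (a⁻¹ * P D * μ B) = (a * a⁻¹) * ((μ B)⁻¹ * μ B) * P D by ring,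
          ENNReal.mul_inv_cancel ha ha', ENNReal.inv_mul_cancel hB (measure_ne_top _ _), one_mul,
          one_mul]
    _ ≤ a * (μ B)⁻¹ * (κ ∘ₘ μ) D := by gcongr
    _ = ((a * (μ B)⁻¹) • (κ ∘ₘ μ)) D := by rw [Measure.smul_apply, smul_eq_mul]

/-- After `P` is replaced by the marginal, marginal times posterior and prior times model are the
same joint law up to a swap. No likelihood ratio is needed, and domination makes the choice of
posterior version irrelevant under `P`. -/
theorem setLIntegral_posterior_le {Ω 𝓧 : Type*} [MeasurableSpace Ω] [StandardBorelSpace Ω]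
    [Nonempty Ω] [MeasurableSpace 𝓧] {κ : Kernel Ω 𝓧} [IsFiniteKernel κ] {μ : Measure Ω}
    [IsFiniteMeasure μ] {P : Measure 𝓧} {K : ℝ≥0∞} (hP : P ≤ K • (κ ∘ₘ μ)) {T : Set 𝓧}
    (hT : MeasurableSet T) {V : Set Ω} (hV : MeasurableSet V) :
    ∫⁻ x in T, (κ†μ) x V ∂P ≤ K * ∫⁻ θ in V, κ θ T ∂μ := by
  calc ∫⁻ x in T, (κ†μ) x V ∂P ≤ ∫⁻ x in T, (κ†μ) x V ∂(K • (κ ∘ₘ μ)) :=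
        lintegral_mono' (Measure.restrict_mono le_rfl hP) le_rfl
    _ = K * ((κ ∘ₘ μ) ⊗ₘ κ†μ) (T ×ˢ V) := by
        rw [Measure.restrict_smul, lintegral_smul_measure, Measure.compProd_apply_prod hT hV,
          smul_eq_mul]
    _ = K * ∫⁻ θ in V, κ θ T ∂μ := by
        rw [compProd_posterior_eq_map_swap, Measure.map_apply measurable_swap (hT.prod hV),
          Set.preimage_swap_prod, Measure.compProd_apply_prod hV hT]

/-! ### Entropy: from covers to brackets to the separation quantity. -/

theorem separationQuantity_le_tsum {ι : Type*} [Countable ι] (n : ℕ) {F : Set BoundaryFunction}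
    (f₀ : BoundaryFunction) (l : ι → BoundaryFunction) (hl : ∀ f ∈ F, ∃ i, l i ≤ f) :
    separationQuantity n F f₀ ≤
      ∑' i, ENNReal.ofReal (Real.exp (-(n * ∫ x, max (l i x - f₀ x) 0))) := by
  obtain ⟨e, he⟩ := exists_injective_nat ι
  have he' : Function.Injective fun i => (e i : ℤ) := Nat.cast_injective.comp he
  let φ := Equiv.ofInjective _ he'
  refine (iInf₂_le_of_le _ (fun j => l (φ.symm j)) (iInf_le _ fun f hf => ?_)).trans_eq ?_
  · obtain ⟨i, hi⟩ := hl f hf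
    exact ⟨φ i, by simpa only [φ.symm_apply_apply] using hi⟩
  · exact φ.symm.tsum_eq fun i => ENNReal.ofReal (Real.exp (-(n * ∫ x, max (l i x - f₀ x) 0)))

theorem integral_posPart_sub_le_add {f l : BoundaryFunction} (hl : l ≤ f) (f₀ : BoundaryFunction) :
    ∫ x, max (f x - f₀ x) 0 ≤ (∫ x, (f x - l x)) + ∫ x, max (l x - f₀ x) 0 := by
  have hi : Integrable (fun x => f x - l x) (volume : Measure unitInterval) :=
    (L1.integrable_coeFn f).sub (L1.integrable_coeFn l)
  rw [← integral_add hi (integrable_posPart_sub l f₀)]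
  refine integral_mono_ae (integrable_posPart_sub f f₀) (hi.add (integrable_posPart_sub l f₀)) ?_
  filter_upwards [(Lp.coeFn_le l f).2 hl] with x hx
  refine max_le ?_ ?_
  · linarith [le_max_left (l x - f₀ x) 0]
  · linarith [le_max_right (l x - f₀ x) 0]

/-- Brackets of size `δ` separate `f₀` from functions exceeding it by at least `δ + c`. -/
theorem separationQuantity_le_bracketingNumberLower (n : ℕ) {F F' : Set BoundaryFunction}
    (hF : F' ⊆ F) (f₀ : BoundaryFunction) {δ c : ℝ}
    (hc : ∀ f ∈ F', δ + c ≤ ∫ x, max (f x - f₀ x) 0) :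
    separationQuantity n F' f₀ ≤
      ((bracketingNumberLower δ F : ℕ∞) : ℝ≥0∞) * ENNReal.ofReal (Real.exp (-(n * c))) := by
  classical
  by_cases htop : bracketingNumberLower δ F = ⊤
  · rw [htop, ENat.toENNReal_top, ENNReal.top_mul (by simp [Real.exp_pos])]
    exact le_top
  -- A finite infimum in `ℕ∞` is attained: a value below the infimum plus one equals it.
  obtain ⟨s, hs⟩ := iInf_lt_iff.1 ((ENat.lt_add_one_iff htop).2 le_rfl)
  obtain ⟨hs, hcard⟩ := iInf_lt_iff.1 hs
  rw [ENat.lt_add_one_iff htop] at hcard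
  -- Only brackets within `δ` below some element of `F'` are kept; each of these still exceeds `f₀`
  -- by at least `c`.
  let t := s.filter fun l => ∃ f ∈ F', l ≤ f ∧ ∫ x, (f x - l x) ≤ δ
  calc separationQuantity n F' f₀
      ≤ ∑' l : t, ENNReal.ofReal (Real.exp (-(n * ∫ x, max (l.1 x - f₀ x) 0))) := by
        refine separationQuantity_le_tsum n f₀ (fun l : t => l.1) fun f hf => ?_
        obtain ⟨l, hls, hlf, hli⟩ := hs f (hF hf)
        exact ⟨⟨l, Finset.mem_filter.2 ⟨hls, f, hf, hlf, hli⟩⟩, hlf⟩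
    _ ≤ ∑' _ : t, ENNReal.ofReal (Real.exp (-(n * c))) := by
        refine ENNReal.tsum_le_tsum fun l => ?_
        obtain ⟨f, hf, hlf, hli⟩ := (Finset.mem_filter.1 l.2).2
        gcongr
        linarith [hc f hf, integral_posPart_sub_le_add hlf f₀]
    _ = (t.card : ℝ≥0∞) * ENNReal.ofReal (Real.exp (-(n * c))) := by
        rw [tsum_fintype, Finset.sum_const, nsmul_eq_mul, Finset.card_univ, Fintype.card_coe]
    _ ≤ _ := by
        gcongr
        rw [← ENat.toENNReal_coe, ENat.toENNReal_le]
        exact (Nat.cast_le.2 (Finset.card_filter_le _ _)).trans hcard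

/-- Lowering each center by `δ` turns a sup-norm ball into a bracket; the gap is at most `2 * δ`
pointwise, hence also in integral as `[0,1]` has mass 1. -/
theorem bracketingNumberLower_le_coveringNumberSup {δ : ℝ} (hδ : 0 ≤ δ)
    (F : Set BoundaryFunction) :
    bracketingNumberLower (2 * δ) F ≤ coveringNumberSup δ F := by
  classical
  refine le_iInf₂ fun s hs => ?_
  refine (iInf₂_le (s.image fun g => g - Lp.const 1 volume δ) fun f hf => ?_).trans
    (Nat.cast_le.2 Finset.card_image_le)
  obtain ⟨g, hg, hfg⟩ := hs f hf
  have h1 : ∀ᵐ x, |f x - g x| ≤ δ := by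
    rw [eLpNorm_exponent_top] at hfg
    filter_upwards [ae_le_eLpNormEssSup (f := ⇑(f - g)) (μ := volume), Lp.coeFn_sub f g]
      with x hx hx'
    have h2 := hx.trans hfg
    rwa [hx', Pi.sub_apply, ← ofReal_norm, ENNReal.ofReal_le_ofReal_iff hδ] at h2
  have h2 : ⇑(g - Lp.const 1 volume δ : BoundaryFunction) =ᵐ[volume] fun x => g x - δ := by
    filter_upwards [Lp.coeFn_sub g (Lp.const 1 volume δ),
      Lp.coeFn_const 1 (volume : Measure unitInterval) δ] with x hx hx'
    rw [hx, Pi.sub_apply, hx']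
    rfl
  refine ⟨_, Finset.mem_image_of_mem _ hg, (Lp.coeFn_le _ _).1 ?_, ?_⟩
  · filter_upwards [h1, h2] with x hx hx'
    rw [hx']
    linarith [(abs_le.1 hx).1]
  · calc ∫ x, (f x - (g - Lp.const 1 volume δ : BoundaryFunction) x)
        ≤ ∫ _ : unitInterval, 2 * δ := by
          refine integral_mono_ae ((L1.integrable_coeFn f).sub (L1.integrable_coeFn _))
            (integrable_const _) ?_
          filter_upwards [h1, h2] with x hx hx'
          change f x - (g - Lp.const 1 volume δ : BoundaryFunction) x ≤ 2 * δ
          rw [hx']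
          linarith [(abs_le.1 hx).2]
      _ = 2 * δ := by simp

/-! ### Posterior mass below and above the truth; the evidence bound. -/

section Posterior

variable {Θ : Type*} [TopologicalSpace Θ] [PolishSpace Θ] [MeasurableSpace Θ] [BorelSpace Θ]
  [Nonempty Θ] {ι : Θ → BoundaryFunction} (hι : Continuous ι) {prior : Measure Θ}
  [IsProbabilityMeasure prior] {f₀ : BoundaryFunction} {n : ℕ}

/-- The expected posterior mass of functions that fall below `f₀` by at least `c`. -/
theorem lintegral_posterior_below_le {K : ℝ≥0∞}
    (hK : boundaryLaw n f₀ ≤ K • (boundaryModel n ι hι ∘ₘ prior)) {c : ℝ} {V : Set Θ}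
    (hV : MeasurableSet V) (hc : ∀ θ ∈ V, c ≤ ∫ x, max (f₀ x - ι θ x) 0) :
    ∫⁻ N, ((boundaryModel n ι hι)†prior) N V ∂(boundaryLaw n f₀)
      ≤ K * ENNReal.ofReal (Real.exp (-(n * c))) := by
  have hG := measurableSet_noPointBelow f₀
  -- Restricting to data with no point below `f₀` costs nothing under `P_{f₀}`, but brings in the
  -- small probability of this event under `P_θ`.
  rw [← Measure.restrict_eq_self_of_ae_mem (ae_boundaryLaw_noPointBelow n (le_refl f₀))]
  refine (setLIntegral_posterior_le hK hG hV).trans ?_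
  gcongr
  calc ∫⁻ θ in V, boundaryModel n ι hι θ {N | N {p | p.2 < f₀ p.1} = 0} ∂prior
      ≤ ∫⁻ _ in V, ENNReal.ofReal (Real.exp (-(n * c))) ∂prior := by
        refine setLIntegral_mono measurable_const fun θ hθ => ?_
        refine (boundaryLaw_noPointBelow n (ι θ) f₀).trans_le ?_
        gcongr
        exact hc θ hθ
    _ ≤ ENNReal.ofReal (Real.exp (-(n * c))) := by
        rw [setLIntegral_const]
        exact mul_le_of_le_one_right' prob_le_one

/-- The expected posterior mass of functions that lie above one of the `l j`. -/
theorem lintegral_posterior_above_le {K : ℝ≥0∞}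
    (hK : boundaryLaw n f₀ ≤ K • (boundaryModel n ι hι ∘ₘ prior)) {J : Type*} [Countable J] (l : J → BoundaryFunction) {V : Set Θ}
    (hV : MeasurableSet V) (hl : ∀ θ ∈ V, ∃ j, l j ≤ ι θ) :
    ∫⁻ N, ((boundaryModel n ι hι)†prior) N V ∂(boundaryLaw n f₀)
      ≤ ∑' j, ENNReal.ofReal (Real.exp (-(n * ∫ x, max (l j x - f₀ x) 0))) := by
  -- `T` is the test. On `T` the posterior is bounded by 1 and a union bound is used; off `T` the
  -- model probability vanishes for every `θ` above some `l j`, so `K` does not enter the bound.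
  set T : Set (Measure (unitInterval × ℝ)) := ⋃ j, {N | N {p | p.2 < l j p.1} = 0} with hTdef
  have hT : MeasurableSet T := MeasurableSet.iUnion fun j => measurableSet_noPointBelow (l j)
  rw [← lintegral_add_compl _ hT]
  have h1 : ∫⁻ N in T, ((boundaryModel n ι hι)†prior) N V ∂(boundaryLaw n f₀) ≤
      ∑' j, ENNReal.ofReal (Real.exp (-(n * ∫ x, max (l j x - f₀ x) 0))) := by
    calc ∫⁻ N in T, ((boundaryModel n ι hι)†prior) N V ∂(boundaryLaw n f₀)
        ≤ ∫⁻ _ in T, 1 ∂(boundaryLaw n f₀) := lintegral_mono fun N => prob_le_one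
      _ = boundaryLaw n f₀ T := setLIntegral_one T
      _ ≤ _ := by
        refine (measure_iUnion_le _).trans_eq ?_
        simp_rw [boundaryLaw_noPointBelow]
  have h2 : ∫⁻ N in Tᶜ, ((boundaryModel n ι hι)†prior) N V ∂(boundaryLaw n f₀) ≤ 0 := by
    refine (setLIntegral_posterior_le hK hT.compl hV).trans_eq ?_
    rw [setLIntegral_congr_fun hV (g := fun _ => 0), lintegral_zero, mul_zero]
    intro θ hθ
    obtain ⟨j, hj⟩ := hl θ hθ
    refine measure_mono_null ?_ (mem_ae_iff.1 (ae_boundaryLaw_noPointBelow n hj))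
    exact Set.compl_subset_compl.2
      (Set.subset_iUnion
        (fun j => {N : Measure (unitInterval × ℝ) | N {p | p.2 < l j p.1} = 0}) j)
  simpa using add_le_add h1 h2

end Posterior

/-- The constraint `ι θ ≤ f₀` is what allows `P_θ` to dominate `P_{f₀}`. The factor `exp (n * r)`
comes from this domination, `exp b` from the prior mass of the ball. -/
theorem boundaryLaw_le_smul_marginal {Θ : Type*} [TopologicalSpace Θ] [MeasurableSpace Θ]
    [BorelSpace Θ] {ι : Θ → BoundaryFunction} (hι : Continuous ι) {prior : Measure Θ}
    [IsFiniteMeasure prior] {f₀ : BoundaryFunction} {n : ℕ} {r b : ℝ}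
    (h : ENNReal.ofReal (Real.exp (-b)) ≤ prior {θ | ‖ι θ - f₀‖ ≤ r ∧ ι θ ≤ f₀}) :
    boundaryLaw n f₀ ≤
      ENNReal.ofReal (Real.exp (n * r + b)) • (boundaryModel n ι hι ∘ₘ prior) := by
  have h0 : prior {θ | ‖ι θ - f₀‖ ≤ r ∧ ι θ ≤ f₀} ≠ 0 :=
    ((ENNReal.ofReal_pos.2 (Real.exp_pos _)).trans_le h).ne'
  refine (le_smul_comp_of_le_smul (κ := boundaryModel n ι hι)
    (a := ENNReal.ofReal (Real.exp (n * r))) (by simp [Real.exp_pos])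
    ENNReal.ofReal_ne_top h0 fun θ hθ => boundaryLaw_le_smul n hθ.2 hθ.1).trans ?_
  refine Measure.le_iff'.2 fun D => ?_
  rw [Measure.smul_apply, Measure.smul_apply, smul_eq_mul, smul_eq_mul, Real.exp_add,
    ENNReal.ofReal_mul (Real.exp_pos _).le]
  gcongr
  refine (ENNReal.inv_le_inv.2 h).trans_eq ?_
  rw [← ENNReal.ofReal_inv_of_pos (Real.exp_pos _), ← Real.exp_neg, neg_neg]

/-- Entropy bounds control the separation quantity. -/
theorem separationQuantity_le_of_bracketingNumberLower_le {n : ℕ} {F F' : Set BoundaryFunction}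
    (hF : F' ⊆ F) {f₀ : BoundaryFunction} {δ η c c' : ℝ} (hc : 1 ≤ c) (hc' : 0 ≤ c')
    (hη : 0 ≤ η) (hδ : δ ≤ 2 * c * η) (hF' : ∀ f ∈ F', 4 * c * η ≤ ∫ x, max (f x - f₀ x) 0)
    (h : ((bracketingNumberLower δ F : ℕ∞) : ℝ≥0∞) ≤
      ENNReal.ofReal (c' * Real.exp (c * n * η))) :
    separationQuantity n F' f₀ ≤ ENNReal.ofReal (c' * Real.exp (-(n * η))) := by
  -- Of the deviation `4 * c * η`, at most `2 * c * η` is lost to the bracket width. The other `2 *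
  -- c * η` pays `c * n * η` for the entropy and leaves `c * n * η ≥ n * η` in the exponent.
  calc separationQuantity n F' f₀
      ≤ ((bracketingNumberLower δ F : ℕ∞) : ℝ≥0∞) *
          ENNReal.ofReal (Real.exp (-(n * (2 * c * η)))) :=
        separationQuantity_le_bracketingNumberLower n hF f₀ fun f hf => by
          linarith [hF' f hf]
    _ ≤ ENNReal.ofReal (c' * Real.exp (c * n * η)) *
          ENNReal.ofReal (Real.exp (-(n * (2 * c * η)))) := by gcongr
    _ = ENNReal.ofReal (c' * Real.exp (-(c * (n * η)))) := by
        rw [← ENNReal.ofReal_mul (by positivity), mul_assoc, ← Real.exp_add]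
        ring_nf
    _ ≤ ENNReal.ofReal (c' * Real.exp (-(n * η))) := by
        refine ENNReal.ofReal_le_ofReal (mul_le_mul_of_nonneg_left (Real.exp_le_exp.2 ?_) hc')
        exact neg_le_neg (le_mul_of_one_le_left (by positivity) hc)

/-! ### Assembling the contraction rate. -/

theorem theorem2p3 (A C C' : ℝ) (hA : 0 < A) (hC : 1 ≤ C) (hC' : 1 ≤ C') :
    ∃ M : ℝ, 0 < M ∧
      ∀ (C'' : ℝ), 1 ≤ C'' →
      -- the Polish space `Θ`, continuously embedded into `L¹([0,1])`, and the prior on it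
      ∀ (Θ : Type*) [TopologicalSpace Θ] [PolishSpace Θ] [MeasurableSpace Θ] [BorelSpace Θ]
        [Nonempty Θ] (ι : Θ → BoundaryFunction) (hι : Continuous ι), Function.Injective ι →
      ∀ (prior : Measure Θ) [IsProbabilityMeasure prior] (f₀ : BoundaryFunction)
        (ε : ℕ → ℝ), (∀ n, 1 ≤ n → 0 < ε n) → Tendsto ε atTop (𝓝 0) →
      ∀ (Θn : ℕ → Set Θ) (n : ℕ), 1 ≤ n →
        -- the entropy condition, or one of its three relaxations
        (((coveringNumberSup (ε n) (ι '' Θn n) : ℕ∞) : ℝ≥0∞)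
              ≤ ENNReal.ofReal (C'' * Real.exp (C' * n * ε n)) ∨
          separationQuantity n
              (ι '' {θ ∈ Θn n | 4 * C' * ε n ≤ ∫ x, max (ι θ x - f₀ x) 0}) f₀
              ≤ ENNReal.ofReal (C'' * Real.exp (-(n * ε n))) ∨
          ((bracketingNumberLower (ε n) (ι '' Θn n) : ℕ∞) : ℝ≥0∞)
              ≤ ENNReal.ofReal (C'' * Real.exp (C' * n * ε n)) ∨
          ((coveringNumberSup (C' * ε n) (ι '' Θn n) : ℕ∞) : ℝ≥0∞)
              ≤ ENNReal.ofReal (C'' * Real.exp (C' * n * ε n))) →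
        -- the one-sided small ball condition
        ENNReal.ofReal (Real.exp (-(C * n * ε n)))
            ≤ prior {θ | ‖ι θ - f₀‖ ≤ A * ε n ∧ ι θ ≤ f₀} →
        -- the remaining mass condition
        prior (Θn n)ᶜ ≤ ENNReal.ofReal (C'' * Real.exp (-((C + A + 1) * n * ε n))) →
        ∫⁻ N, ((boundaryModel n ι hι)†prior) N {θ | M * ε n ≤ ‖ι θ - f₀‖} ∂(boundaryLaw n f₀)
          ≤ ENNReal.ofReal (3 * C'' * Real.exp (-(n * ε n))) := by
  -- `4 * C'` is the threshold for deviations above `f₀`, `A + C + 1` the one for deviations below.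
  refine ⟨4 * C' + (A + C + 1), by positivity, ?_⟩
  intro C'' hC'' Θ _ _ _ _ _ ι hι _ prior _ f₀ ε hε _ Θn n hn hent hball hrem
  have hε := hε n hn
  set F : Set BoundaryFunction := ι '' Θn n
  set F' : Set BoundaryFunction :=
    ι '' {θ ∈ Θn n | 4 * C' * ε n ≤ ∫ x, max (ι θ x - f₀ x) 0} with hF'
  have hsub : F' ⊆ F := Set.image_mono fun θ hθ => hθ.1
  have hF'2 : ∀ f ∈ F', 4 * C' * ε n ≤ ∫ x, max (f x - f₀ x) 0 := by
    rintro _ ⟨θ, hθ, rfl⟩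
    exact hθ.2
  -- The width `2 * C' * ε n` accommodates all three entropy conditions; it is reached by covers of
  -- radius `C' * ε n`.
  have hbrack : ∀ δ ≤ 2 * C' * ε n, ((bracketingNumberLower δ F : ℕ∞) : ℝ≥0∞) ≤
      ENNReal.ofReal (C'' * Real.exp (C' * n * ε n)) →
      separationQuantity n F' f₀ ≤ ENNReal.ofReal (C'' * Real.exp (-(n * ε n))) :=
    fun δ hδ => separationQuantity_le_of_bracketingNumberLower_le hsub hC' (by positivity)
      hε.le hδ hF'2
  have hCε : ε n ≤ C' * ε n := le_mul_of_one_le_left hε.le hC'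
  have hsep : separationQuantity n F' f₀ ≤ ENNReal.ofReal (C'' * Real.exp (-(n * ε n))) := by
    rcases hent with h | h | h | h
    · exact hbrack (2 * ε n) (by linarith) ((ENat.toENNReal_le.2
        (bracketingNumberLower_le_coveringNumberSup hε.le F)).trans h)
    · exact h
    · exact hbrack (ε n) (by linarith) h
    · exact hbrack (2 * (C' * ε n)) (by linarith) ((ENat.toENNReal_le.2
        (bracketingNumberLower_le_coveringNumberSup (by positivity) F)).trans h)
  have hK := boundaryLaw_le_smul_marginal (n := n) hι hball
  set post := (boundaryModel n ι hι)†prior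
  set P := boundaryLaw n f₀
  -- `Θn n` need not be measurable, so its complement is replaced by a measurable hull of the same
  -- prior mass.
  set H : Set Θ := toMeasurable prior (Θn n)ᶜ
  have hH : MeasurableSet H := measurableSet_toMeasurable _ _
  set U : Set Θ := {θ | (4 * C' + (A + C + 1)) * ε n ≤ ‖ι θ - f₀‖}
  have hU : MeasurableSet U :=
    (isClosed_le continuous_const (hι.sub continuous_const).norm).measurableSet
  set V : Set Θ := {θ | (A + C + 1) * ε n ≤ ∫ x, max (f₀ x - ι θ x) 0}
  have hV : MeasurableSet V :=
    (isClosed_le continuous_const ((continuous_integral_posPart_sub f₀).comp hι)).measurableSet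
  have hW : MeasurableSet ((U \ H) \ V) := (hU.diff hH).diff hV
  have hremaining : ∫⁻ N, post N H ∂P ≤ ENNReal.ofReal (C'' * Real.exp (-(n * ε n))) := by
    rw [← setLIntegral_univ]
    refine (setLIntegral_posterior_le hK MeasurableSet.univ hH).trans ?_
    simp only [measure_univ, setLIntegral_one]
    calc _ ≤ ENNReal.ofReal (Real.exp (n * (A * ε n) + C * n * ε n)) *
          ENNReal.ofReal (C'' * Real.exp (-((C + A + 1) * n * ε n))) := by
          gcongr
          exact (measure_toMeasurable _).trans_le hrem
      _ = ENNReal.ofReal (C'' * Real.exp (-(n * ε n))) := by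
          rw [← ENNReal.ofReal_mul (by positivity), mul_left_comm, ← Real.exp_add]
          ring_nf
  -- The change of measure consumes `A + C` of the threshold `A + C + 1`; the remaining 1 gives the
  -- rate.
  have hbelow : ∫⁻ N, post N V ∂P ≤ ENNReal.ofReal (C'' * Real.exp (-(n * ε n))) := by
    refine (lintegral_posterior_below_le hι hK hV fun θ hθ => hθ).trans ?_
    rw [← ENNReal.ofReal_mul (by positivity), ← Real.exp_add]
    refine ENNReal.ofReal_le_ofReal ?_
    rw [show n * (A * ε n) + C * n * ε n + -(n * ((A + C + 1) * ε n)) = -(n * ε n) by ring]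
    exact le_mul_of_one_le_left (Real.exp_pos _).le hC''
  -- Outside `V` the deviation below `f₀` is less than `(A + C + 1) * ε n`, so in `U` the deviation
  -- above `f₀` must exceed `4 * C' * ε n`. The bound holds for every admissible family, hence for
  -- the infimum.
  have habove : ∫⁻ N, post N ((U \ H) \ V) ∂P ≤ separationQuantity n F' f₀ := by
    refine le_iInf₂ fun J l => le_iInf fun hl => ?_
    refine lintegral_posterior_above_le hι hK l hW fun θ hθ => hl _ ⟨θ, ⟨?_, ?_⟩, rfl⟩
    · exact not_not.1 fun h => hθ.1.2 (subset_toMeasurable _ _ h)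
    · have h1 : (4 * C' + (A + C + 1)) * ε n ≤ ‖ι θ - f₀‖ := hθ.1.1
      have h2 : ∫ x, max (f₀ x - ι θ x) 0 < (A + C + 1) * ε n := lt_of_not_ge hθ.2
      rw [norm_sub_eq_add_integral_posPart] at h1
      linarith
  calc ∫⁻ N, post N U ∂P
      ≤ ∫⁻ N, (post N H + post N V + post N ((U \ H) \ V)) ∂P := by
        refine lintegral_mono fun N => ?_
        refine (measure_mono (t := H ∪ V ∪ ((U \ H) \ V)) fun θ hθ => ?_).trans
          ((measure_union_le _ _).trans (add_le_add_left (measure_union_le _ _) _))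
        by_cases h1 : θ ∈ H <;> by_cases h2 : θ ∈ V <;> simp [h1, h2, hθ]
    _ = ∫⁻ N, post N H ∂P + ∫⁻ N, post N V ∂P + ∫⁻ N, post N ((U \ H) \ V) ∂P := by
        rw [lintegral_add_right _ (post.measurable_coe hW),
          lintegral_add_right _ (post.measurable_coe hV)]
    _ ≤ ENNReal.ofReal (C'' * Real.exp (-(n * ε n))) +
          ENNReal.ofReal (C'' * Real.exp (-(n * ε n))) +
          ENNReal.ofReal (C'' * Real.exp (-(n * ε n))) :=
        add_le_add (add_le_add hremaining hbelow) (habove.trans hsep)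
    _ = ENNReal.ofReal (3 * C'' * Real.exp (-(n * ε n))) := by
        rw [← ENNReal.ofReal_add (by positivity) (by positivity),
          ← ENNReal.ofReal_add (by positivity) (by positivity)]
        ring_nf
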